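/- For positive integers $s_1,\dots,s_k$ with $s_1\ge 2$ let $$\zeta(s_1,\dots,s_k)=\sum_{n_1>\cdots>n_k\ge 1}\frac{1}{n_1^{s_1}\cdots n_k^{s_k}},$$ and let $\{1\}^r$ denote the string $1,\dots,1$ with $r$ terms ($r\ge 0$). **Theorem 1.3.** For positive integers $m,n,j,k,s,t$ we have $$\begin{aligned} &\zeta(m+1,\{1\}^{j-1})\,\zeta(n+1,\{1\}^{k-1},s+1,\{1\}^{t-1})\\ &=\sum_{\substack{0\le n_1\le n\\ j_1+j_2+j_3+j_4=j\\ |\alpha|=n-n_1+j_1+1\\ |\bar\alpha|=s+j_3}}\binom{m-1+n_1}{m-1}\binom{j_2+k-1}{k-1}\binom{j_4+t-1}{t-1}\\ &\qquad\quad\times\zeta(\alpha_1+m+n_1,\alpha_2,\dots,\alpha_{j_1+1},\{1\}^{j_2+k-1},\bar\alpha_1+1,\bar\alpha_2,\dots,\bar\alpha_{j_3+1},\{1\}^{j_4+t-1})\\ &+\sum_{\substack{1\le k_1\le k\\ 0\le m_1\le m-1}}\binom{m_1+n-1}{n-1}\sum_{\substack{j_1+j_2+j_3=j\\ |\beta|=m-m_1+k_1\\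 |\bar\beta|=s+j_2}}\binom{j_1+k-k_1}{k-k_1}\binom{j_3+t-1}{t-1}\\ &\qquad\quad\times\zeta(\beta_1+m_1+n,\beta_2,\dots,\beta_{k_1},\beta_{k_1+1}+1,\{1\}^{j_1+k-k_1-1},\bar\beta_1+1,\bar\beta_2,\dots,\bar\beta_{j_2+1},\{1\}^{j_3+t-1})\\ &+\sum_{\substack{1\le s_1\le s\\ m_1+m_2+m_3=m-1}}\binom{m_1+n-1}{n-1}\binom{m_3+s_1-1}{s_1-1}\sum_{\substack{j_1+j_2=j\\ |\gamma|=m_2+k+1\\ |\bar\gamma|=s-s_1+j_1+1}}\binom{j_2+t-1}{t-1}\\ &\qquad\quad\times\zeta(\gamma_1+m_1+n,\gamma_2,\dots,\gamma_k,\gamma_{k+1}+\bar\gamma_1+m_3+s_1,\bar\gamma_2,\dots,\bar\gamma_{j_1+1},\{1\}^{j_2+t-1})\\ &+\sum_{\substack{1\le t_1\le t\\ m_1+m_2+m_3+m_4=m-1}}\binom{m_1+n-1}{n-1}\binom{m_3+s-1}{s-1}\binom{j+t-t_1}{j}\\ &\qquad\quad\times\sum_{\substack{|\delta|=m_2+k\\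 |\bar\delta|=m_4+t_1+1}}\zeta(\delta_1+m_1+n,\delta_2,\dots,\delta_k,\bar\delta_1+m_3+s,\bar\delta_2,\dots,\bar\delta_{t_1},\bar\delta_{t_1+1}+1,\{1\}^{j+t-t_1-1}). \end{aligned}$$ Here all $j_i,m_i$ are nonnegative integers; $\alpha,\bar\alpha,\beta,\bar\beta,\gamma,\bar\gamma,\delta,\bar\delta$ run over the tuples of positive integers of lengths $j_1+1,\ j_3+1,\ k_1+1,\ j_2+1,\ k+1,\ j_1+1,\ k,\ t_1+1$ respectively, $|\cdot|$ denoting the sum of the entries; a string $\alpha_1+c,\alpha_2,\dots,\alpha_{i}$ with $i=1$ is read as $\alpha_1+c$, and a string $\alpha_2,\dots,\alpha_i$ with $i=1$ is empty. In the second family, when $j_1=0$ and $k_1=k$, the string $\beta_{k_1+1}+1,\{1\}^{-1},\bar\beta_1+1$ is read as the single entry $\beta_{k_1+1}+\bar\beta_1+1$. -/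

import Mathlib

/-- The multiple zeta value
`ζ(s₁, …, s_k) = ∑_{n₁ > ⋯ > n_k ≥ 1} 1 / (n₁ ^ s₁ ⋯ n_k ^ s_k)`,
as the sum of a (nonnegative) real family; it converges when all entries are positive and
`s₁ ≥ 2`. -/
noncomputable def mzv (s : List ℕ) : ℝ :=
  ∑' n : {n : Fin s.length → ℕ+ // StrictAnti n},
    ∏ i : Fin s.length, 1 / (((n.1 i : ℕ) : ℝ) ^ s.get i)

/-- The compositions `a = (a₁, …, a_d)` of `w` into exactly `d` parts: `a_i ≥ 1` and
`a₁ + ⋯ + a_d = w`. -/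
def compositions (d w : ℕ) : Finset (Fin d → ℕ) :=
  (Finset.Nat.antidiagonalTuple d w).filter fun a => ∀ i, 1 ≤ a i

/-- The string `{1}^r`. -/
def ones (r : ℕ) : List ℕ := List.replicate r 1

/-- `(u₁ + c, u₂, …, u_p)`. -/
def addFirst (c : ℕ) (u : List ℕ) : List ℕ := u.modifyHead (· + c)

/-- `(u₁, …, u_{p-1}, u_p + c)`. -/
def addLast (c : ℕ) (u : List ℕ) : List ℕ := u.modifyLast (· + c)

/-- `(u₁, …, u_{p-1}, u_p + v₁ + c, v₂, …, v_q)`, for nonempty strings `u` and `v`. -/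
def fuse (c : ℕ) (u v : List ℕ) : List ℕ :=
  u.dropLast ++ (u.getLastD 0 + v.headD 0 + c) :: v.tail

/-- For nonempty strings `u`, `v` of positive integers, the string `(u, {1}^{r-1}, v)`. For `r = 0`
the string `(…, a, {1}^{-1}, b, …)` is taken to be `(…, a + b - 1, …)`: in terms of words,
`(u, {1}^{r-1}, v)` encodes `x₀^{u₁-1} x₁ ⋯ x₁ x₀^{u_p-1} x₁^r x₀^{v₁-1} x₁ ⋯ x₀^{v_q-1} x₁`. -/
def withOnes (r : ℕ) (u v : List ℕ) : List ℕ :=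
  if r = 0 then u.dropLast ++ (u.getLastD 0 + v.headD 0 - 1) :: v.tail
  else u ++ ones (r - 1) ++ v

/-! Encode a string as the word x₀^{s₁-1} x₁ ⋯ x₀^{s_k-1} x₁; products of multiple zeta values then
become shuffles of words. The two words here are x₀^m x₁^j and x₀^n x₁^k x₀^s x₁^t. Mark the last x₀
of the first word and sort the shuffle by the prefix of the second word that precedes it
(`shuffle_append_cons`). The prefix ends in one of the four blocks of the second word, and this
gives the four families of the formula, with n₁, k₁, s₁, t₁ counting the letters used from that
block.

On each side of the marked letter a power of a single letter is shuffled with a word made of blocks.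
Marking further letters at the block boundaries cuts this into shuffles of two powers: equal letters
give a binomial coefficient (`shuffle_replicate_self`), distinct letters give every word with those
letters, hence a sum over compositions (`shuffle_eq_sum_openWord`). The identity holds in every real
algebra (`shuffle_eq_sum_zetaWord`).

For the analysis, the letters become the operators of integration against dx/x and dx/(1-x) on
formal power series. A word applied to 1 is a multiple polylogarithm, and differentiation shows that
shuffles become products (`shuffle_polylogOp`). Summing coefficients evaluates at x = 1; absolute
convergence makes this multiplicative on the series involved (`exists_linearMap_eq_mzv`). -/

/-! ### Shuffles of binary words and the words of strings. -/

section Shuffle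

variable {R : Type*} [Ring R] (e : Bool → R)

/-- The product in a ring of the letters of a binary word. -/
def letterProd (w : List Bool) : R := (w.map e).prod

/-- The image in a ring of the shuffle product of two binary words. -/
def shuffle : List Bool → List Bool → R
  | [], v => letterProd e v
  | a :: u, [] => letterProd e (a :: u)
  | a :: u, b :: v => e a * shuffle u (b :: v) + e b * shuffle (a :: u) v
termination_by u v => u.length + v.length

@[simp] theorem letterProd_nil : letterProd e [] = 1 := rfl

@[simp] theorem letterProd_cons (a : Bool) (w : List Bool) :
    letterProd e (a :: w) = e a * letterProd e w := by simp [letterProd]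

@[simp] theorem letterProd_append (u v : List Bool) :
    letterProd e (u ++ v) = letterProd e u * letterProd e v := by simp [letterProd]

@[simp] theorem letterProd_replicate (p : ℕ) (a : Bool) :
    letterProd e (List.replicate p a) = e a ^ p := by simp [letterProd]

@[simp] theorem shuffle_nil_left (v : List Bool) : shuffle e [] v = letterProd e v := by
  rw [shuffle]

@[simp] theorem shuffle_nil_right (u : List Bool) : shuffle e u [] = letterProd e u := by
  cases u <;> rw [shuffle]

theorem shuffle_cons_cons (a b : Bool) (u v : List Bool) :
    shuffle e (a :: u) (b :: v) = e a * shuffle e u (b :: v) + e b * shuffle e (a :: u) v := by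
  rw [shuffle]

theorem shuffle_comm (u v : List Bool) : shuffle e u v = shuffle e v u := by
  induction u generalizing v with
  | nil => simp
  | cons a u ihu =>
    induction v with
    | nil => simp
    | cons b v ihv => rw [shuffle_cons_cons, shuffle_cons_cons, ihu, ihv, add_comm]

/-- A shuffle decomposed according to the position of a given letter of the first word. -/
theorem shuffle_append_cons (u₁ u₂ v : List Bool) (a : Bool) :
    shuffle e (u₁ ++ a :: u₂) v = ∑ i ∈ Finset.range (v.length + 1),
      shuffle e u₁ (v.take i) * e a * shuffle e u₂ (v.drop i) := by
  induction u₁ generalizing v with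
  | nil =>
    induction v with
    | nil => simp
    | cons b v ih =>
      rw [List.length_cons, Finset.sum_range_succ', List.nil_append, shuffle_cons_cons]
      rw [List.nil_append] at ih
      rw [ih, add_comm]
      simp [Finset.mul_sum, mul_assoc]
  | cons c u₁ ihu =>
    induction v with
    | nil => simp [mul_assoc]
    | cons b v ih =>
      rw [List.length_cons, Finset.sum_range_succ', List.cons_append, shuffle_cons_cons]
      rw [List.cons_append] at ih
      rw [ih, ihu, List.length_cons, Finset.sum_range_succ']
      simp only [List.take_succ_cons, List.drop_succ_cons, shuffle_cons_cons, Finset.mul_sum,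
        add_mul, mul_add, Finset.sum_add_distrib, mul_assoc, List.take_zero, List.drop_zero,
        shuffle_nil_right, letterProd_cons]
      abel

/-- The shuffle of a power of a letter, decomposed according to the position of a given letter of
the second word. -/
theorem shuffle_replicate_append_cons (p : ℕ) (a b : Bool) (v₁ v₂ : List Bool) :
    shuffle e (List.replicate p a) (v₁ ++ b :: v₂) = ∑ x ∈ Finset.HasAntidiagonal.antidiagonal p,
      shuffle e (List.replicate x.1 a) v₁ * e b * shuffle e (List.replicate x.2 a) v₂ := by
  rw [shuffle_comm, shuffle_append_cons, Finset.Nat.sum_antidiagonal_eq_sum_range_succ_mk,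
    List.length_replicate]
  refine Finset.sum_congr rfl fun i hi => ?_
  rw [List.take_replicate, List.drop_replicate, min_eq_left (by simp at hi; omega),
    shuffle_comm e v₁, shuffle_comm e v₂]

/-- The recursion of the shuffle is Pascal's rule. -/
theorem shuffle_replicate_self [Algebra ℝ R] (p q : ℕ) (a : Bool) :
    shuffle e (List.replicate p a) (List.replicate q a) =
      ((p + q).choose p : ℝ) • e a ^ (p + q) := by
  induction p generalizing q with
  | zero => simp
  | succ p ihp =>
    induction q with
    | zero => simp [pow_succ']
    | succ q ihq =>
      rw [List.replicate_succ, List.replicate_succ, shuffle_cons_cons, ← List.replicate_succ,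
        ← List.replicate_succ, ihp, ihq, mul_smul_comm, mul_smul_comm, ← pow_succ', ← pow_succ',
        show p + 1 + (q + 1) = (p + q + 1) + 1 by ring, show p + (q + 1) = p + q + 1 by ring,
        show p + 1 + q = p + q + 1 by ring, ← add_smul,
        Nat.choose_succ_succ (p + q + 1)]
      push_cast
      rfl

/-- The word `x₀^{s₁-1} x₁ ⋯ x₀^{s_k-1} x₁` of a string, in a ring. -/
def zetaWord (s : List ℕ) : R := (s.map fun a => e false ^ (a - 1) * e true).prod

/-- The word of a nonempty string without its last letter. -/
def openWord (s : List ℕ) : R := zetaWord e s.dropLast * e false ^ (s.getLastD 0 - 1)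

@[simp] theorem zetaWord_nil : zetaWord e [] = 1 := rfl

@[simp] theorem zetaWord_cons (a : ℕ) (s : List ℕ) :
    zetaWord e (a :: s) = e false ^ (a - 1) * e true * zetaWord e s := by simp [zetaWord]

@[simp] theorem zetaWord_append (u v : List ℕ) :
    zetaWord e (u ++ v) = zetaWord e u * zetaWord e v := by simp [zetaWord]

@[simp] theorem zetaWord_ones (r : ℕ) : zetaWord e (ones r) = e true ^ r := by
  simp [zetaWord, ones]

theorem openWord_concat (u : List ℕ) (a : ℕ) :
    openWord e (u ++ [a]) = zetaWord e u * e false ^ (a - 1) := by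
  simp [openWord]

theorem openWord_mul {u : List ℕ} (hu : u ≠ []) : openWord e u * e true = zetaWord e u := by
  obtain ⟨u, a, rfl⟩ := List.eq_nil_or_concat' u |>.resolve_left hu
  simp [openWord_concat, mul_assoc]

theorem openWord_cons_of_ne_nil (a : ℕ) {u : List ℕ} (hu : u ≠ []) :
    openWord e (a :: u) = e false ^ (a - 1) * e true * openWord e u := by
  obtain ⟨u, b, rfl⟩ := List.eq_nil_or_concat' u |>.resolve_left hu
  rw [← List.cons_append, openWord_concat, openWord_concat, zetaWord_cons, mul_assoc]

theorem openWord_singleton (a : ℕ) : openWord e [a] = e false ^ (a - 1) := by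
  simp [openWord]

theorem zetaWord_addFirst (c : ℕ) {u : List ℕ} (hu : u ≠ []) (hpos : ∀ a ∈ u, 1 ≤ a) :
    zetaWord e (addFirst c u) = e false ^ c * zetaWord e u := by
  cases u with
  | nil => exact absurd rfl hu
  | cons a u =>
    have := hpos a (by simp)
    simp only [addFirst, List.modifyHead_cons, zetaWord_cons, ← mul_assoc, ← pow_add]
    congr 4; omega

theorem openWord_addFirst (c : ℕ) {u : List ℕ} (hu : u ≠ []) (hpos : ∀ a ∈ u, 1 ≤ a) :
    openWord e (addFirst c u) = e false ^ c * openWord e u := by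
  cases u with
  | nil => exact absurd rfl hu
  | cons a u =>
    have := hpos a (by simp)
    have h : a + c - 1 = c + (a - 1) := by omega
    rcases eq_or_ne u [] with rfl | hu'
    · simp [addFirst, openWord_singleton, ← pow_add, h]
    · simp [addFirst, openWord_cons_of_ne_nil e _ hu', ← mul_assoc, ← pow_add, h]

theorem addLast_concat (c : ℕ) (u : List ℕ) (a : ℕ) : addLast c (u ++ [a]) = u ++ [a + c] := by
  simp [addLast, List.modifyLast_concat]

theorem openWord_addLast (c : ℕ) {u : List ℕ} (hu : u ≠ []) (hpos : ∀ a ∈ u, 1 ≤ a) :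
    openWord e (addLast c u) = openWord e u * e false ^ c := by
  obtain ⟨u, a, rfl⟩ := List.eq_nil_or_concat' u |>.resolve_left hu
  have := hpos a (by simp)
  rw [addLast_concat, openWord_concat, openWord_concat, mul_assoc, ← pow_add]
  congr 2; omega

/-- An entry a has a - 1 letters x₀, so a merged entry a + b + c has c + 1 letters x₀ beyond those
of a and b. -/
theorem zetaWord_fuse (c : ℕ) {u v : List ℕ} (hu : u ≠ []) (hupos : ∀ a ∈ u, 1 ≤ a)
    (hv : v ≠ []) (hvpos : ∀ a ∈ v, 1 ≤ a) :
    zetaWord e (fuse c u v) = openWord e u * e false ^ (c + 1) * zetaWord e v := by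
  obtain ⟨u, a, rfl⟩ := List.eq_nil_or_concat' u |>.resolve_left hu
  obtain ⟨b, v, rfl⟩ := List.exists_cons_of_ne_nil hv
  have := hupos a (by simp)
  have := hvpos b (by simp)
  have h : a + b + c - 1 = a - 1 + (c + 1) + (b - 1) := by omega
  simp [fuse, openWord_concat, mul_assoc, h, pow_add]

theorem zetaWord_withOnes (r : ℕ) {u v : List ℕ} (hu : u ≠ []) (hupos : ∀ a ∈ u, 1 ≤ a)
    (hv : v ≠ []) (hvpos : ∀ a ∈ v, 1 ≤ a) :
    zetaWord e (withOnes r u v) = openWord e u * e true ^ r * zetaWord e v := by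
  obtain _ | r := r
  · obtain ⟨u, a, rfl⟩ := List.eq_nil_or_concat' u |>.resolve_left hu
    obtain ⟨b, v, rfl⟩ := List.exists_cons_of_ne_nil hv
    have := hupos a (by simp)
    have := hvpos b (by simp)
    have h : a + b - 1 - 1 = a - 1 + (b - 1) := by omega
    simp [withOnes, openWord_concat, mul_assoc, h, pow_add]
  · simp [withOnes, ← openWord_mul e hu, mul_assoc, pow_succ']

end Shuffle

/-! ### Compositions as words with prescribed numbers of letters. -/

section Compositions

open Finset.HasAntidiagonal

theorem sum_antidiagonalTuple_succ {M : Type*} [AddCommMonoid M] (d w : ℕ)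
    (f : (Fin (d + 1) → ℕ) → M) :
    ∑ a ∈ Finset.Nat.antidiagonalTuple (d + 1) w, f a =
      ∑ x ∈ antidiagonal w, ∑ b ∈ Finset.Nat.antidiagonalTuple d x.2, f (Fin.cons x.1 b) := by
  rw [Finset.sum_sigma']
  refine Finset.sum_bij' (fun a _ => ⟨(a 0, ∑ i, Fin.tail a i), Fin.tail a⟩)
    (fun p _ => Fin.cons p.1.1 p.2) ?_ ?_ ?_ ?_ ?_
  · intro a ha
    simp only [Finset.Nat.mem_antidiagonalTuple, Fin.sum_univ_succ] at ha
    simp [Finset.Nat.mem_antidiagonalTuple, ← ha, Fin.tail]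
  · rintro ⟨⟨x, y⟩, b⟩ h
    simp only [Finset.mem_sigma, Finset.HasAntidiagonal.mem_antidiagonal, Finset.Nat.mem_antidiagonalTuple] at h
    simp [Finset.Nat.mem_antidiagonalTuple, Fin.sum_univ_succ, h.1, h.2]
  · intro a _
    simp
  · rintro ⟨⟨x, y⟩, b⟩ h
    simp only [Finset.mem_sigma, Finset.HasAntidiagonal.mem_antidiagonal, Finset.Nat.mem_antidiagonalTuple] at h
    simp [h.2]
  · intro a _
    simp

theorem sum_antidiagonalTuple_two {M : Type*} [AddCommMonoid M] (w : ℕ) (f : ℕ → ℕ → M) :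
    ∑ a ∈ Finset.Nat.antidiagonalTuple 2 w, f (a 0) (a 1) =
      ∑ x ∈ antidiagonal w, f x.1 x.2 := by
  rw [sum_antidiagonalTuple_succ]
  simp [Finset.Nat.antidiagonalTuple_one]

theorem sum_antidiagonalTuple_three {M : Type*} [AddCommMonoid M] (w : ℕ) (f : ℕ → ℕ → ℕ → M) :
    ∑ a ∈ Finset.Nat.antidiagonalTuple 3 w, f (a 0) (a 1) (a 2) =
      ∑ x ∈ antidiagonal w, ∑ y ∈ antidiagonal x.2, f x.1 y.1 y.2 := by
  rw [sum_antidiagonalTuple_succ]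
  exact Finset.sum_congr rfl fun x _ => sum_antidiagonalTuple_two x.2 (f x.1)

theorem sum_antidiagonalTuple_four {M : Type*} [AddCommMonoid M] (w : ℕ)
    (f : ℕ → ℕ → ℕ → ℕ → M) :
    ∑ a ∈ Finset.Nat.antidiagonalTuple 4 w, f (a 0) (a 1) (a 2) (a 3) =
      ∑ x ∈ antidiagonal w, ∑ y ∈ antidiagonal x.2, ∑ z ∈ antidiagonal y.2,
        f x.1 y.1 z.1 z.2 := by
  rw [sum_antidiagonalTuple_succ]
  exact Finset.sum_congr rfl fun x _ => sum_antidiagonalTuple_three x.2 (f x.1)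

theorem mem_compositions {d w : ℕ} {a : Fin d → ℕ} :
    a ∈ compositions d w ↔ ∑ i, a i = w ∧ ∀ i, 1 ≤ a i := by
  simp [compositions, Finset.Nat.mem_antidiagonalTuple]

/-- Lowering every part by one counts the letters x₀ of each entry, which may be zero; the induction
on words runs on these counts. -/
theorem sum_compositions {M : Type*} [AddCommMonoid M] (d w : ℕ) (f : (Fin d → ℕ) → M) :
    ∑ a ∈ compositions d (w + d), f a =
      ∑ b ∈ Finset.Nat.antidiagonalTuple d w, f (fun i => b i + 1) := by
  refine Finset.sum_bij' (fun a _ i => a i - 1) (fun b _ i => b i + 1) ?_ ?_ ?_ ?_ ?_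
  · intro a ha
    obtain ⟨h, hpos⟩ := mem_compositions.1 ha
    have h' : ∑ i, (a i - 1 + 1) = w + d := by
      rw [← h]; exact Finset.sum_congr rfl fun i _ => Nat.sub_add_cancel (hpos i)
    rw [Finset.Nat.mem_antidiagonalTuple]
    simpa [Finset.sum_add_distrib] using h'
  · intro b hb
    rw [Finset.Nat.mem_antidiagonalTuple] at hb
    simp [mem_compositions, Finset.sum_add_distrib, hb]
  · intro a ha
    exact funext fun i => Nat.sub_add_cancel ((mem_compositions.1 ha).2 i)
  · intro b _
    simp
  · intro a ha
    congr 1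
    exact funext fun i => (Nat.sub_add_cancel ((mem_compositions.1 ha).2 i)).symm

theorem pos_of_mem_ofFn {d w : ℕ} {a : Fin d → ℕ} (ha : a ∈ compositions d w) :
    ∀ x ∈ List.ofFn a, 1 ≤ x := by
  simpa [List.mem_ofFn] using (mem_compositions.1 ha).2

variable {R : Type*} [Ring R] (e : Bool → R)

/-- The shuffle of `x₀^a` and `x₁^b` is the sum of all words with these letters. -/
theorem shuffle_eq_sum_openWord (a b : ℕ) :
    shuffle e (List.replicate a false) (List.replicate b true) =
      ∑ α ∈ compositions (b + 1) (a + (b + 1)), openWord e (List.ofFn α) := by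
  rw [sum_compositions]
  induction b generalizing a with
  | zero => simp [Finset.Nat.antidiagonalTuple_one, openWord_singleton]
  | succ b ih =>
    rw [sum_antidiagonalTuple_succ]
    -- Split at the first x₁: the letters x₀ before it make up the first entry.
    have := shuffle_replicate_append_cons e a false true [] (List.replicate b true)
    rw [List.nil_append, ← List.replicate_succ] at this
    rw [this]
    refine Finset.sum_congr rfl fun x _ => ?_
    rw [ih, shuffle_nil_right, letterProd_replicate, Finset.mul_sum]
    refine Finset.sum_congr rfl fun β _ => ?_
    have h : List.ofFn (fun i => (Fin.cons x.1 β : Fin (b + 1 + 1) → ℕ) i + 1) =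
        (x.1 + 1) :: List.ofFn (fun i => β i + 1) := by
      rw [List.ofFn_succ]; simp
    rw [h, openWord_cons_of_ne_nil e _ (by simp), Nat.add_sub_cancel]

theorem shuffle_mul_eq_sum_zetaWord (a b : ℕ) :
    shuffle e (List.replicate a false) (List.replicate b true) * e true =
      ∑ α ∈ compositions (b + 1) (a + (b + 1)), zetaWord e (List.ofFn α) := by
  rw [shuffle_eq_sum_openWord, Finset.sum_mul]
  exact Finset.sum_congr rfl fun α _ => openWord_mul e (by simp)

end Compositions

/-! ### The four families, one for each block in which the prefix can end. -/

section WordIdentity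

variable {R : Type*} [Ring R] (e : Bool → R)

theorem shuffle_replicate_two (p : ℕ) (a b : Bool) (v₁ v₂ : List Bool) :
    shuffle e (List.replicate p a) (v₁ ++ b :: v₂) =
      ∑ J ∈ Finset.Nat.antidiagonalTuple 2 p, shuffle e (List.replicate (J 0) a) v₁ * e b *
        shuffle e (List.replicate (J 1) a) v₂ := by
  rw [shuffle_replicate_append_cons]
  exact (sum_antidiagonalTuple_two p fun x y => shuffle e (List.replicate x a) v₁ * e b *
        shuffle e (List.replicate y a) v₂).symm

theorem shuffle_replicate_three (p : ℕ) (a b c : Bool) (v₁ v₂ v₃ : List Bool) :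
    shuffle e (List.replicate p a) (v₁ ++ b :: (v₂ ++ c :: v₃)) =
      ∑ J ∈ Finset.Nat.antidiagonalTuple 3 p, shuffle e (List.replicate (J 0) a) v₁ * e b *
        (shuffle e (List.replicate (J 1) a) v₂ * e c *
          shuffle e (List.replicate (J 2) a) v₃) := by
  simp only [shuffle_replicate_append_cons, Finset.mul_sum]
  exact (sum_antidiagonalTuple_three p fun x y z => shuffle e (List.replicate x a) v₁ * e b *
        (shuffle e (List.replicate y a) v₂ * e c * shuffle e (List.replicate z a) v₃)).symm

theorem shuffle_replicate_four (p : ℕ) (a b c d : Bool) (v₁ v₂ v₃ v₄ : List Bool) :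
    shuffle e (List.replicate p a) (v₁ ++ b :: (v₂ ++ c :: (v₃ ++ d :: v₄))) =
      ∑ J ∈ Finset.Nat.antidiagonalTuple 4 p, shuffle e (List.replicate (J 0) a) v₁ * e b *
        (shuffle e (List.replicate (J 1) a) v₂ * e c *
          (shuffle e (List.replicate (J 2) a) v₃ * e d *
            shuffle e (List.replicate (J 3) a) v₄)) := by
  simp only [shuffle_replicate_append_cons, Finset.mul_sum]
  exact (sum_antidiagonalTuple_four p fun x y z w => shuffle e (List.replicate x a) v₁ * e b *
        (shuffle e (List.replicate y a) v₂ * e c * (shuffle e (List.replicate z a) v₃ * e d *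
          shuffle e (List.replicate w a) v₄))).symm

theorem shuffle_mul_eq_sum_zetaWord_comm (a b : ℕ) :
    shuffle e (List.replicate b true) (List.replicate a false) * e true =
      ∑ α ∈ compositions (b + 1) (a + b + 1), zetaWord e (List.ofFn α) := by
  rw [shuffle_comm, shuffle_mul_eq_sum_zetaWord]; rfl

theorem ofFn_succ_ne_nil {d : ℕ} (α : Fin (d + 1) → ℕ) : List.ofFn α ≠ [] := by simp

theorem addFirst_ne_nil (c : ℕ) {u : List ℕ} (hu : u ≠ []) : addFirst c u ≠ [] := by
  simpa [addFirst] using hu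

theorem addLast_ne_nil (c : ℕ) {u : List ℕ} (hu : u ≠ []) : addLast c u ≠ [] := by
  obtain ⟨u, a, rfl⟩ := List.eq_nil_or_concat' u |>.resolve_left hu
  simp [addLast_concat]

theorem addFirst_pos (c : ℕ) {u : List ℕ} (hu : ∀ a ∈ u, 1 ≤ a) : ∀ a ∈ addFirst c u, 1 ≤ a := by
  cases u with
  | nil => simp [addFirst]
  | cons a u => simp [addFirst] at hu ⊢; exact ⟨by omega, hu.2⟩

theorem addLast_pos (c : ℕ) {u : List ℕ} (hu : ∀ a ∈ u, 1 ≤ a) : ∀ a ∈ addLast c u, 1 ≤ a := by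
  rcases List.eq_nil_or_concat' u with rfl | ⟨u, a, rfl⟩
  · simp [addLast, List.modifyLast, List.modifyLast.go]
  · rw [addLast_concat]
    intro b hb
    rcases List.mem_append.1 hb with hb | hb
    · exact hu b (by simp [hb])
    · have := hu a (by simp)
      simp at hb; omega

variable [Algebra ℝ R]

theorem shuffle_replicate_self' (p q : ℕ) (a : Bool) :
    shuffle e (List.replicate p a) (List.replicate q a) =
      ((p + q).choose q : ℝ) • e a ^ (p + q) := by
  rw [shuffle_replicate_self, Nat.choose_symm_add]

/-- The prefix is x₀^{n₁}. Behind the marked x₀, cuts at the first letters of the three remaining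
blocks distribute the j letters x₁ into four groups. -/
theorem shuffle_family_first (m n₁ q j k s t : ℕ) :
    shuffle e (List.replicate m false) (List.replicate n₁ false) * e false *
      shuffle e (List.replicate j true) (List.replicate q false ++ true ::
        (List.replicate k true ++ false :: (List.replicate s false ++ true ::
          List.replicate t true))) =
    ∑ J ∈ Finset.Nat.antidiagonalTuple 4 j, ∑ α ∈ compositions (J 0 + 1) (q + J 0 + 1),
      ∑ α' ∈ compositions (J 2 + 1) (s + 1 + J 2),
        (((m + n₁).choose m : ℝ) * ((J 1 + k).choose k : ℝ) * ((J 3 + t).choose t : ℝ)) •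
          zetaWord e (addFirst (m + 1 + n₁) (List.ofFn α) ++ ones (J 1 + k) ++
            addFirst 1 (List.ofFn α') ++ ones (J 3 + t)) := by
  rw [shuffle_replicate_four, Finset.mul_sum]
  refine Finset.sum_congr rfl fun J _ => ?_
  have h : ∀ α ∈ compositions (J 0 + 1) (q + J 0 + 1),
      ∀ α' ∈ compositions (J 2 + 1) (s + 1 + J 2),
      (((m + n₁).choose m : ℝ) * ((J 1 + k).choose k : ℝ) * ((J 3 + t).choose t : ℝ)) •
          zetaWord e (addFirst (m + 1 + n₁) (List.ofFn α) ++ ones (J 1 + k) ++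
            addFirst 1 (List.ofFn α') ++ ones (J 3 + t)) =
      (((m + n₁).choose m : ℝ) * ((J 1 + k).choose k : ℝ) * ((J 3 + t).choose t : ℝ)) •
        (e false ^ (m + 1 + n₁) * zetaWord e (List.ofFn α) * e true ^ (J 1 + k) * e false *
          zetaWord e (List.ofFn α') * e true ^ (J 3 + t)) := by
    intro α hα α' hα'
    simp only [zetaWord_append, zetaWord_ones,
      zetaWord_addFirst e _ (ofFn_succ_ne_nil _) (pos_of_mem_ofFn hα),
      zetaWord_addFirst e _ (ofFn_succ_ne_nil _) (pos_of_mem_ofFn hα'), pow_one, mul_assoc]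
  rw [Finset.sum_congr rfl fun α hα => Finset.sum_congr rfl fun α' hα' => h α hα α' hα']
  simp_rw [← Finset.smul_sum, ← Finset.sum_mul, ← Finset.mul_sum, ← Finset.sum_mul,
    ← Finset.mul_sum]
  rw [add_right_comm s 1, ← shuffle_mul_eq_sum_zetaWord_comm, ← shuffle_mul_eq_sum_zetaWord_comm,
    shuffle_replicate_self, shuffle_replicate_self', shuffle_replicate_self',
    show m + 1 + n₁ = m + n₁ + 1 by ring, pow_succ]
  simp only [smul_mul_assoc, mul_smul_comm, smul_smul, mul_assoc]
  congr 1; ring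

/-- The prefix ends in the first x₁-block, so the marked x₀ enlarges an entry that is still open.
The next x₁ may be missing when no x₁ is left before the following x₀; `withOnes` then merges the
two entries. -/
theorem shuffle_family_second (m n k₁ q j s t : ℕ) :
    shuffle e (List.replicate m false) (List.replicate n false ++ false :: List.replicate k₁ true) *
      e false * shuffle e (List.replicate j true) (List.replicate q true ++ false ::
        (List.replicate s false ++ true :: List.replicate t true)) =
    ∑ m₁ ∈ Finset.range (m + 1), ((m₁ + n).choose n : ℝ) •
      ∑ J ∈ Finset.Nat.antidiagonalTuple 3 j,
        ∑ β ∈ compositions (k₁ + 1) (m + 1 - m₁ + k₁),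
        ∑ β' ∈ compositions (J 1 + 1) (s + 1 + J 1),
          (((J 0 + q).choose q : ℝ) * ((J 2 + t).choose t : ℝ)) •
          zetaWord e (withOnes (J 0 + q) (addLast 1 (addFirst (m₁ + (n + 1)) (List.ofFn β)))
            (addFirst 1 (List.ofFn β')) ++ ones (J 2 + t)) := by
  rw [shuffle_replicate_append_cons, Finset.Nat.sum_antidiagonal_eq_sum_range_succ_mk,
    Finset.sum_mul, Finset.sum_mul]
  refine Finset.sum_congr rfl fun m₁ hm₁ => ?_
  rw [shuffle_replicate_three, Finset.mul_sum, Finset.smul_sum]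
  refine Finset.sum_congr rfl fun J _ => ?_
  have h : ∀ β ∈ compositions (k₁ + 1) (m + 1 - m₁ + k₁),
      ∀ β' ∈ compositions (J 1 + 1) (s + 1 + J 1),
      (((J 0 + q).choose q : ℝ) * ((J 2 + t).choose t : ℝ)) •
          zetaWord e (withOnes (J 0 + q) (addLast 1 (addFirst (m₁ + (n + 1)) (List.ofFn β)))
            (addFirst 1 (List.ofFn β')) ++ ones (J 2 + t)) =
      (((J 0 + q).choose q : ℝ) * ((J 2 + t).choose t : ℝ)) •
        (e false ^ (m₁ + (n + 1)) * openWord e (List.ofFn β) * e false * e true ^ (J 0 + q) *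
          e false * zetaWord e (List.ofFn β') * e true ^ (J 2 + t)) := by
    intro β hβ β' hβ'
    have h1 := ofFn_succ_ne_nil β
    have h2 := pos_of_mem_ofFn hβ
    have h3 := ofFn_succ_ne_nil β'
    have h4 := pos_of_mem_ofFn hβ'
    rw [zetaWord_append, zetaWord_ones, zetaWord_withOnes e _
      (addLast_ne_nil _ (addFirst_ne_nil _ h1)) (addLast_pos _ (addFirst_pos _ h2))
      (addFirst_ne_nil _ h3) (addFirst_pos _ h4), zetaWord_addFirst e _ h3 h4,
      openWord_addLast e _ (addFirst_ne_nil _ h1) (addFirst_pos _ h2), openWord_addFirst e _ h1 h2]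
    simp only [pow_one, mul_assoc]
  rw [Finset.sum_congr rfl fun α hα => Finset.sum_congr rfl fun α' hα' => h α hα α' hα']
  simp_rw [← Finset.smul_sum, ← Finset.sum_mul, ← Finset.mul_sum, ← Finset.sum_mul,
    ← Finset.mul_sum]
  -- The truncated subtractions agree because m₁ ≤ m.
  have hm : m + 1 - m₁ + k₁ = (m - m₁) + (k₁ + 1) := by
    rw [Finset.mem_range] at hm₁; omega
  rw [add_right_comm s 1, hm, ← shuffle_mul_eq_sum_zetaWord_comm, ← shuffle_eq_sum_openWord,
    shuffle_replicate_self', shuffle_replicate_self', shuffle_replicate_self',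
    ← add_assoc, pow_succ]
  simp only [smul_mul_assoc, mul_smul_comm, smul_smul, mul_assoc]
  congr 1; ring

/-- The prefix ends in the second x₀-block, so the marked letter lies inside a run of x₀. That run
joins the open entry on its left to the first entry on its right, whence `fuse`. The prefix takes s₁
+ 1 letters of the block, the first of them being a cut. -/
theorem shuffle_family_third (m n k s₁ q j t : ℕ) :
    shuffle e (List.replicate m false) (List.replicate n false ++ false ::
        (List.replicate k true ++ false :: List.replicate s₁ false)) *
      e false * shuffle e (List.replicate j true) (List.replicate q false ++ true ::
        List.replicate t true) =
    ∑ M ∈ Finset.Nat.antidiagonalTuple 3 m,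
      (((M 0 + n).choose n : ℝ) * ((M 2 + s₁).choose s₁ : ℝ)) •
      ∑ J ∈ Finset.Nat.antidiagonalTuple 2 j,
        ∑ γ ∈ compositions (k + 1) (M 1 + k + 1),
        ∑ γ' ∈ compositions (J 0 + 1) (q + J 0 + 1),
          ((J 1 + t).choose t : ℝ) •
          zetaWord e (fuse (M 2 + (s₁ + 1)) (addFirst (M 0 + (n + 1)) (List.ofFn γ))
            (List.ofFn γ') ++ ones (J 1 + t)) := by
  rw [shuffle_replicate_three, Finset.sum_mul, Finset.sum_mul]
  refine Finset.sum_congr rfl fun M _ => ?_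
  rw [shuffle_replicate_two, Finset.mul_sum, Finset.smul_sum]
  refine Finset.sum_congr rfl fun J _ => ?_
  have h : ∀ γ ∈ compositions (k + 1) (M 1 + k + 1),
      ∀ γ' ∈ compositions (J 0 + 1) (q + J 0 + 1),
      ((J 1 + t).choose t : ℝ) •
          zetaWord e (fuse (M 2 + (s₁ + 1)) (addFirst (M 0 + (n + 1)) (List.ofFn γ))
            (List.ofFn γ') ++ ones (J 1 + t)) =
      ((J 1 + t).choose t : ℝ) •
        (e false ^ (M 0 + (n + 1)) * openWord e (List.ofFn γ) * e false ^ (M 2 + (s₁ + 1) + 1) *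
          zetaWord e (List.ofFn γ') * e true ^ (J 1 + t)) := by
    intro γ hγ γ' hγ'
    have h1 := ofFn_succ_ne_nil γ
    have h2 := pos_of_mem_ofFn hγ
    rw [zetaWord_append, zetaWord_ones, zetaWord_fuse e _ (addFirst_ne_nil _ h1)
      (addFirst_pos _ h2) (ofFn_succ_ne_nil γ') (pos_of_mem_ofFn hγ'), openWord_addFirst e _ h1 h2]
  rw [Finset.sum_congr rfl fun α hα => Finset.sum_congr rfl fun α' hα' => h α hα α' hα']
  simp_rw [← Finset.smul_sum, ← Finset.sum_mul, ← Finset.mul_sum, ← Finset.sum_mul,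
    ← Finset.mul_sum]
  rw [← shuffle_mul_eq_sum_zetaWord_comm, add_assoc (M 1), ← shuffle_eq_sum_openWord,
    shuffle_replicate_self', shuffle_replicate_self', shuffle_replicate_self',
    ← add_assoc (M 0), pow_succ, ← add_assoc (M 2), pow_succ _ (M 2 + s₁ + 1),
    pow_succ' _ (M 2 + s₁)]
  simp only [smul_mul_assoc, mul_smul_comm, smul_smul, mul_assoc]
  congr 1; ring

/-- The prefix reaches the last block, so only letters x₁ follow the marked x₀. The first of them
closes the open entry, which needs j + q ≥ 1 and leaves j + q - 1 ones. -/
theorem shuffle_family_fourth (m n k s t₁ q j : ℕ) (hj : 1 ≤ j) :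
    shuffle e (List.replicate m false) (List.replicate n false ++ false ::
        (List.replicate k true ++ true :: (List.replicate s false ++ false ::
          List.replicate t₁ true))) *
      e false * shuffle e (List.replicate j true) (List.replicate q true) =
    ∑ M ∈ Finset.Nat.antidiagonalTuple 4 m,
      (((M 0 + n).choose n : ℝ) * ((M 2 + s).choose s : ℝ) * ((j + q).choose j : ℝ)) •
        ∑ δ ∈ compositions (k + 1) (M 1 + (k + 1)),
        ∑ δ' ∈ compositions (t₁ + 1) (M 3 + t₁ + 1),
          zetaWord e (addFirst (M 0 + (n + 1)) (List.ofFn δ) ++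
            addLast 1 (addFirst (M 2 + (s + 1)) (List.ofFn δ')) ++ ones (j + q - 1)) := by
  rw [shuffle_replicate_four, Finset.sum_mul, Finset.sum_mul]
  refine Finset.sum_congr rfl fun M _ => ?_
  have h : ∀ δ ∈ compositions (k + 1) (M 1 + (k + 1)),
      ∀ δ' ∈ compositions (t₁ + 1) (M 3 + t₁ + 1),
      zetaWord e (addFirst (M 0 + (n + 1)) (List.ofFn δ) ++
            addLast 1 (addFirst (M 2 + (s + 1)) (List.ofFn δ')) ++ ones (j + q - 1)) =
        e false ^ (M 0 + (n + 1)) * zetaWord e (List.ofFn δ) * e false ^ (M 2 + (s + 1)) *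
          openWord e (List.ofFn δ') * e false * e true ^ (j + q) := by
    intro δ hδ δ' hδ'
    have h1 := ofFn_succ_ne_nil δ'
    have h2 := pos_of_mem_ofFn hδ'
    rw [zetaWord_append, zetaWord_ones, zetaWord_append,
      zetaWord_addFirst e _ (ofFn_succ_ne_nil δ) (pos_of_mem_ofFn hδ),
      ← openWord_mul e (addLast_ne_nil _ (addFirst_ne_nil _ h1)),
      openWord_addLast e _ (addFirst_ne_nil _ h1) (addFirst_pos _ h2), openWord_addFirst e _ h1 h2]
    obtain ⟨r, hr⟩ : ∃ r, j + q = r + 1 := ⟨j + q - 1, by omega⟩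
    rw [hr, Nat.add_sub_cancel, pow_succ' _ r, pow_one]
    simp only [mul_assoc]
  rw [Finset.sum_congr rfl fun α hα => Finset.sum_congr rfl fun α' hα' => h α hα α' hα']
  simp_rw [← Finset.sum_mul, ← Finset.mul_sum, ← Finset.sum_mul, ← Finset.mul_sum]
  rw [← shuffle_mul_eq_sum_zetaWord, add_assoc (M 3), ← shuffle_eq_sum_openWord,
    shuffle_replicate_self', shuffle_replicate_self', shuffle_replicate_self,
    ← add_assoc (M 0), pow_succ, ← add_assoc (M 2), pow_succ]
  simp only [smul_mul_assoc, mul_smul_comm, smul_smul, mul_assoc]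
  congr 1; ring

end WordIdentity

/-! ### Assembling the families into one identity of words. -/

section WordIdentity

theorem sum_Icc_one_eq_sum_range {M : Type*} [AddCommMonoid M] (f : ℕ → M) (p : ℕ) :
    ∑ i ∈ Finset.Icc 1 p, f i = ∑ i ∈ Finset.range p, f (i + 1) := by
  rw [Finset.range_eq_Ico, Finset.sum_Ico_add' f 0 p 1]
  rfl

/-- Peels one block off a sum over nonempty prefixes. A prefix ending at a block boundary is
assigned to the earlier block, so later blocks count from 1. -/
theorem sum_range_take_drop_replicate {M : Type*} [AddCommMonoid M]
    (f : List Bool → List Bool → M) (p : ℕ) (a : Bool) (w : List Bool) :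
    ∑ i ∈ Finset.range (List.replicate p a ++ w).length,
        f ((List.replicate p a ++ w).take (i + 1)) ((List.replicate p a ++ w).drop (i + 1)) =
      ∑ i ∈ Finset.Icc 1 p, f (List.replicate i a) (List.replicate (p - i) a ++ w) +
      ∑ i ∈ Finset.range w.length, f (List.replicate p a ++ w.take (i + 1)) (w.drop (i + 1)) := by
  rw [List.length_append, List.length_replicate, Finset.sum_range_add, sum_Icc_one_eq_sum_range]
  congr 1
  · refine Finset.sum_congr rfl fun i hi => ?_
    have hi : i + 1 ≤ p := by simpa using hi
    rw [List.take_append_of_le_length (by simpa), List.drop_append_of_le_length (by simpa),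
      List.take_replicate, List.drop_replicate, min_eq_left hi]
  · refine Finset.sum_congr rfl fun i hi => ?_
    rw [List.take_append, List.drop_append, List.length_replicate, add_assoc,
      Nat.add_sub_cancel_left, List.take_of_length_le (by simp), List.drop_of_length_le (by simp),
      List.nil_append]

/-- The empty prefix goes to the first block, which is why n₁ alone starts at 0. -/
theorem sum_range_succ_take_drop_replicate {M : Type*} [AddCommMonoid M]
    (f : List Bool → List Bool → M) (p : ℕ) (a : Bool) (w : List Bool) :
    ∑ i ∈ Finset.range ((List.replicate p a ++ w).length + 1),
        f ((List.replicate p a ++ w).take i) ((List.replicate p a ++ w).drop i) =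
      ∑ i ∈ Finset.range (p + 1), f (List.replicate i a) (List.replicate (p - i) a ++ w) +
      ∑ i ∈ Finset.range w.length, f (List.replicate p a ++ w.take (i + 1)) (w.drop (i + 1)) := by
  rw [Finset.sum_range_succ', sum_range_take_drop_replicate, Finset.sum_range_succ' _ p,
    sum_Icc_one_eq_sum_range]
  simp [add_right_comm]

variable {R : Type*} [Ring R] [Algebra ℝ R] (e : Bool → R)

/-- The shuffle of `x₀^(m+1) x₁^j` and `x₀^(n+1) x₁^(k+1) x₀^(s+1) x₁^(t+1)`, as a sum of words. -/
theorem shuffle_eq_sum_zetaWord (m n j k s t : ℕ) (hj : 1 ≤ j) :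
    shuffle e (List.replicate m false ++ false :: List.replicate j true)
      (List.replicate (n + 1) false ++ (List.replicate (k + 1) true ++
        (List.replicate (s + 1) false ++ (List.replicate (t + 1) true ++ [])))) =
      (∑ n₁ ∈ Finset.range (n + 1 + 1), ∑ J ∈ Finset.Nat.antidiagonalTuple 4 j,
        ∑ α ∈ compositions (J 0 + 1) (n + 1 - n₁ + J 0 + 1),
        ∑ α' ∈ compositions (J 2 + 1) (s + 1 + J 2),
          (((m + n₁).choose m : ℝ) * ((J 1 + k).choose k : ℝ) * ((J 3 + t).choose t : ℝ)) •
          zetaWord e (addFirst (m + 1 + n₁) (List.ofFn α) ++ ones (J 1 + k) ++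
            addFirst 1 (List.ofFn α') ++ ones (J 3 + t))) +
      (∑ k₁ ∈ Finset.Icc 1 (k + 1), ∑ m₁ ∈ Finset.range (m + 1), ((m₁ + n).choose n : ℝ) •
        ∑ J ∈ Finset.Nat.antidiagonalTuple 3 j,
        ∑ β ∈ compositions (k₁ + 1) (m + 1 - m₁ + k₁),
        ∑ β' ∈ compositions (J 1 + 1) (s + 1 + J 1),
          (((J 0 + (k + 1) - k₁).choose (k + 1 - k₁) : ℝ) * ((J 2 + t).choose t : ℝ)) •
          zetaWord e (withOnes (J 0 + (k + 1) - k₁)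
            (addLast 1 (addFirst (m₁ + (n + 1)) (List.ofFn β)))
            (addFirst 1 (List.ofFn β')) ++ ones (J 2 + t))) +
      (∑ s₁ ∈ Finset.Icc 1 (s + 1), ∑ M ∈ Finset.Nat.antidiagonalTuple 3 m,
        (((M 0 + n).choose n : ℝ) * ((M 2 + s₁ - 1).choose (s₁ - 1) : ℝ)) •
        ∑ J ∈ Finset.Nat.antidiagonalTuple 2 j,
        ∑ γ ∈ compositions (k + 1 + 1) (M 1 + (k + 1) + 1),
        ∑ γ' ∈ compositions (J 0 + 1) (s + 1 - s₁ + J 0 + 1),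
          ((J 1 + t).choose t : ℝ) •
          zetaWord e (fuse (M 2 + s₁) (addFirst (M 0 + (n + 1)) (List.ofFn γ)) (List.ofFn γ') ++
            ones (J 1 + t))) +
      (∑ t₁ ∈ Finset.Icc 1 (t + 1), ∑ M ∈ Finset.Nat.antidiagonalTuple 4 m,
        (((M 0 + n).choose n : ℝ) * ((M 2 + s).choose s : ℝ) *
          ((j + (t + 1) - t₁).choose j : ℝ)) •
        ∑ δ ∈ compositions (k + 1) (M 1 + (k + 1)),
        ∑ δ' ∈ compositions (t₁ + 1) (M 3 + t₁ + 1),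
          zetaWord e (addFirst (M 0 + (n + 1)) (List.ofFn δ) ++
            addLast 1 (addFirst (M 2 + (s + 1)) (List.ofFn δ')) ++
              ones (j + (t + 1) - t₁ - 1))) := by
  rw [shuffle_append_cons, sum_range_succ_take_drop_replicate (fun u v =>
      shuffle e (List.replicate m false) u * e false * shuffle e (List.replicate j true) v),
    sum_range_take_drop_replicate (fun u v =>
      shuffle e (List.replicate m false) (List.replicate (n + 1) false ++ u) * e false *
        shuffle e (List.replicate j true) v),
    sum_range_take_drop_replicate (fun u v =>
      shuffle e (List.replicate m false) (List.replicate (n + 1) false ++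
        (List.replicate (k + 1) true ++ u)) * e false * shuffle e (List.replicate j true) v),
    sum_range_take_drop_replicate (fun u v =>
      shuffle e (List.replicate m false) (List.replicate (n + 1) false ++
        (List.replicate (k + 1) true ++ (List.replicate (s + 1) false ++ u))) * e false *
          shuffle e (List.replicate j true) v),
    List.length_nil, Finset.range_zero, Finset.sum_empty, add_zero, ← add_assoc, ← add_assoc]
  -- For blocks lying wholly in the prefix, the cutting letter exposed here is the last of its
  -- block.
  have hsplit : ∀ (p : ℕ) (a : Bool) (w : List Bool),
      List.replicate (p + 1) a ++ w = List.replicate p a ++ a :: w := by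
    intro p a w
    rw [List.replicate_succ', List.append_assoc, List.singleton_append]
  congr 1
  · congr 1
    · congr 1
      · refine Finset.sum_congr rfl fun n₁ _ => ?_
        rw [← shuffle_family_first]
        simp [List.replicate_succ]
      · refine Finset.sum_congr rfl fun k₁ hk₁ => ?_
        rw [Finset.mem_Icc] at hk₁
        simp only [Nat.add_sub_assoc hk₁.2]
        rw [← shuffle_family_second, hsplit]
        simp [List.replicate_succ]
    · refine Finset.sum_congr rfl fun s₁ hs₁ => ?_
      rw [Finset.mem_Icc] at hs₁
      obtain ⟨s₁, rfl⟩ := Nat.exists_eq_add_of_le' hs₁.1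
      refine Eq.trans ?_ (shuffle_family_third e m n (k + 1) s₁ (s + 1 - (s₁ + 1)) j t)
      rw [hsplit n]
      simp [List.replicate_succ]
  · refine Finset.sum_congr rfl fun t₁ ht₁ => ?_
    rw [Finset.mem_Icc] at ht₁
    simp only [Nat.add_sub_assoc ht₁.2]
    rw [← shuffle_family_fourth e _ _ _ _ _ _ _ hj, hsplit n, hsplit k, hsplit s]
    simp

end WordIdentity

/-! ### Multiple polylogarithms as formal power series. -/

section Polylog

open PowerSeries

/-- The operators `f ↦ ∫ f dx/x` and `f ↦ ∫ f dx/(1-x)` on power series. -/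
noncomputable def polylogOp : Bool → Module.End ℝ ℝ⟦X⟧
  | false =>
    { toFun := fun f => PowerSeries.mk fun n => coeff n f / n
      map_add' := fun f g => by ext n; simp [add_div]
      map_smul' := fun c f => by ext n; simp [mul_div_assoc] }
  | true =>
    { toFun := fun f => PowerSeries.mk fun n => (∑ i ∈ Finset.range n, coeff i f) / n
      map_add' := fun f g => by ext n; simp [add_div, Finset.sum_add_distrib]
      map_smul' := fun c f => by ext n; simp [← Finset.mul_sum, mul_div_assoc] }

theorem coeff_polylogOp_false (f : ℝ⟦X⟧) (n : ℕ) :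
    coeff n (polylogOp false f) = coeff n f / n := by
  simp [polylogOp]

theorem coeff_polylogOp_true (f : ℝ⟦X⟧) (n : ℕ) :
    coeff n (polylogOp true f) = (∑ i ∈ Finset.range n, coeff i f) / n := by
  simp [polylogOp]

theorem constantCoeff_polylogOp (a : Bool) (f : ℝ⟦X⟧) : constantCoeff (polylogOp a f) = 0 := by
  rw [← coeff_zero_eq_constantCoeff_apply]
  cases a
  · simp [coeff_polylogOp_false]
  · simp [coeff_polylogOp_true]

/-- `(1 - x) x ω` for the differential forms `ω = dx/x` and `ω = dx/(1-x)`. -/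
noncomputable def polylogForm : Bool → ℝ⟦X⟧
  | false => 1 - X
  | true => X

/-- Clearing the denominators x and 1 - x keeps everything in power series. For dx/x the constant
term must vanish: division by n = 0 yields 0 and would lose it. -/
theorem derivative_polylogOp (a : Bool) (f : ℝ⟦X⟧) (hf : a = false → constantCoeff f = 0) :
    (1 - X) * (X * derivative ℝ (polylogOp a f)) = polylogForm a * f := by
  cases a
  · have : X * derivative ℝ (polylogOp false f) = f := by
      ext n
      cases n with
      | zero => simp [hf rfl]
      | succ n =>
        rw [coeff_succ_X_mul, coeff_derivative, coeff_polylogOp_false]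
        push_cast
        field_simp
    rw [this]; rfl
  · have h : ∀ n, coeff n (X * derivative ℝ (polylogOp true f)) =
        ∑ i ∈ Finset.range n, coeff i f := by
      intro n
      cases n with
      | zero => simp
      | succ n =>
        rw [coeff_succ_X_mul, coeff_derivative, coeff_polylogOp_true]
        push_cast
        field_simp
    ext n
    rw [sub_mul, one_mul, map_sub, h]
    cases n with
    | zero => simp [polylogForm]
    | succ n =>
      rw [coeff_succ_X_mul, h, Finset.sum_range_succ, polylogForm, coeff_succ_X_mul]
      ring

theorem eq_of_derivative_eq {f g : ℝ⟦X⟧} (h0 : constantCoeff f = constantCoeff g)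
    (h : (1 - X) * (X * derivative ℝ f) = (1 - X) * (X * derivative ℝ g)) : f = g := by
  have hX : (1 - X : ℝ⟦X⟧) ≠ 0 := by
    intro h
    have := congrArg (constantCoeff (R := ℝ)) h
    simp at this
  exact derivative.ext (mul_left_cancel₀ X_ne_zero (mul_left_cancel₀ hX h)) h0

/-- The words that are empty or end in `x₁`. -/
def EndsInOne : List Bool → Prop
  | [] => True
  | false :: w => w ≠ [] ∧ EndsInOne w
  | true :: w => EndsInOne w

theorem endsInOne_replicate_true (p : ℕ) : EndsInOne (List.replicate p true) := by
  induction p with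
  | zero => trivial
  | succ p ih => exact ih

theorem EndsInOne.append_left {w : List Bool} (hw : EndsInOne w) (hne : w ≠ []) (u : List Bool) :
    EndsInOne (u ++ w) := by
  induction u with
  | nil => exact hw
  | cons a u ih =>
    cases a
    · exact ⟨by simp [hne], ih⟩
    · exact ih

theorem constantCoeff_letterProd_polylogOp {w : List Bool} (hw : w ≠ []) :
    constantCoeff (letterProd polylogOp w 1) = 0 := by
  cases w with
  | nil => exact absurd rfl hw
  | cons a w => rw [letterProd_cons, Module.End.mul_apply, constantCoeff_polylogOp]

theorem EndsInOne.of_cons {a : Bool} {u : List Bool} (h : EndsInOne (a :: u)) :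
    EndsInOne u ∧ (a = false → constantCoeff (letterProd polylogOp u 1) = 0) := by
  cases a
  · exact ⟨h.2, fun _ => constantCoeff_letterProd_polylogOp h.1⟩
  · exact ⟨h, fun h => by simp at h⟩

/-- The shuffle product formula for the power series of multiple polylogarithms. -/
theorem shuffle_polylogOp (u v : List Bool) (hu : EndsInOne u) (hv : EndsInOne v) :
    shuffle polylogOp u v 1 = letterProd polylogOp u 1 * letterProd polylogOp v 1 := by
  induction u generalizing v with
  | nil => simp
  | cons a u ihu =>
    induction v with
    | nil => simp
    | cons b v ihv =>
      obtain ⟨hu', hu0⟩ := hu.of_cons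
      obtain ⟨hv', hv0⟩ := hv.of_cons
      rw [shuffle_cons_cons, LinearMap.add_apply, Module.End.mul_apply, Module.End.mul_apply,
        ihu _ hu' hv, ihv hv']
      have hA := derivative_polylogOp a _ hu0
      have hB := derivative_polylogOp b _ hv0
      simp only [letterProd_cons, Module.End.mul_apply]
      set U := letterProd polylogOp u 1
      set V := letterProd polylogOp v 1
      have h1 := derivative_polylogOp a (U * polylogOp b V)
        (fun _ => by rw [map_mul, constantCoeff_polylogOp, mul_zero])
      have h2 := derivative_polylogOp b (polylogOp a U * V)
        (fun _ => by rw [map_mul, constantCoeff_polylogOp, zero_mul])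
      -- Both sides vanish at 0, so it suffices to compare derivatives; the Leibniz rule reproduces
      -- the two terms of the shuffle recursion.
      refine eq_of_derivative_eq (by simp [constantCoeff_polylogOp]) ?_
      rw [map_add, mul_add, mul_add, h1, h2, Derivation.leibniz, smul_eq_mul, smul_eq_mul]
      linear_combination (-polylogOp b V) * hA - polylogOp a U * hB

/-- The power series `∑ x^{n₁} / (n₁^{s₁} ⋯ n_k^{s_k})` over `n₁ > ⋯ > n_k ≥ 1`. -/
noncomputable def polylog (s : List ℕ) : ℝ⟦X⟧ := zetaWord polylogOp s 1

theorem coeff_polylogOp_false_pow (p : ℕ) (f : ℝ⟦X⟧) (n : ℕ) :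
    coeff n ((polylogOp false ^ p) f) = coeff n f / (n : ℝ) ^ p := by
  induction p with
  | zero => simp
  | succ p ih =>
    rw [pow_succ', Module.End.mul_apply, coeff_polylogOp_false, ih, div_div, pow_succ]

theorem coeff_polylog_cons {a : ℕ} (ha : 1 ≤ a) (s : List ℕ) (n : ℕ) :
    coeff n (polylog (a :: s)) = (∑ i ∈ Finset.range n, coeff i (polylog s)) / (n : ℝ) ^ a := by
  obtain ⟨a, rfl⟩ := Nat.exists_eq_add_of_le' ha
  rw [polylog, zetaWord_cons, Module.End.mul_apply, Module.End.mul_apply,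
    coeff_polylogOp_false_pow, coeff_polylogOp_true, div_div, Nat.add_sub_cancel, ← pow_succ']
  rfl

theorem coeff_polylog_nil (n : ℕ) : coeff n (polylog []) = if n = 0 then 1 else 0 := by
  simp [polylog, coeff_one]

theorem coeff_polylog_nonneg {s : List ℕ} (hs : ∀ a ∈ s, 1 ≤ a) (n : ℕ) :
    0 ≤ coeff n (polylog s) := by
  induction s generalizing n with
  | nil => rw [coeff_polylog_nil]; split_ifs <;> norm_num
  | cons a s ih =>
    rw [coeff_polylog_cons (hs a (by simp))]
    exact div_nonneg (Finset.sum_nonneg fun i _ => ih (fun b hb => hs b (by simp [hb])) i)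
      (by positivity)

/-- True growth is a power of log n; √n is a cruder bound that survives induction, since 1/√n
telescopes up to a factor 4. It leaves n^{-3/2} once the first exponent is at least 2. -/
theorem sum_coeff_polylog_le {s : List ℕ} (hs : ∀ a ∈ s, 1 ≤ a) (n : ℕ) :
    ∑ i ∈ Finset.range n, coeff i (polylog s) ≤ 4 ^ s.length * √(n : ℝ) := by
  induction s generalizing n with
  | nil =>
    rcases Nat.eq_zero_or_pos n with rfl | hn
    · simp
    · simp only [coeff_polylog_nil, Finset.sum_ite_eq', Finset.mem_range, hn, if_true]
      simpa using Nat.one_le_iff_ne_zero.2 hn.ne'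
  | cons a s ih =>
    have hs' : ∀ b ∈ s, 1 ≤ b := fun b hb => hs b (by simp [hb])
    induction n with
    | zero => simp
    | succ n ihn =>
      rw [Finset.sum_range_succ, coeff_polylog_cons (hs a (by simp))]
      rcases Nat.eq_zero_or_pos n with rfl | hn
      · simp
      have hn1 : (1 : ℝ) ≤ n := by exact_mod_cast hn
      have hsq : 1 ≤ √(n : ℝ) := by simpa using Real.sqrt_le_sqrt hn1
      have hx : √(n : ℝ) * √(n : ℝ) = n := Real.mul_self_sqrt (by positivity)
      have hy : √((n : ℝ) + 1) * √((n : ℝ) + 1) = n + 1 := Real.mul_self_sqrt (by positivity)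
      have hy0 : 0 ≤ √((n : ℝ) + 1) := Real.sqrt_nonneg _
      have hle : √((n : ℝ) + 1) ≤ 3 * √(n : ℝ) := by nlinarith
      have h1 : (∑ i ∈ Finset.range n, coeff i (polylog s)) / (n : ℝ) ^ a ≤
          4 ^ s.length * √(n : ℝ) / n := by
        refine div_le_div₀ (by positivity) (ih hs' n) (by positivity) ?_
        exact le_self_pow₀ hn1 (by have := hs a (by simp); omega)
      -- √(n+1) - √n is the inverse of √(n+1) + √n, which is at most 4√n by `hle`.
      have h2 : √(n : ℝ) / n ≤ 4 * (√((n : ℝ) + 1) - √(n : ℝ)) := by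
        rw [div_le_iff₀ (by positivity)]
        nlinarith
      have h3 : 4 ^ s.length * √(n : ℝ) / n ≤
          4 ^ s.length * (4 * (√((n : ℝ) + 1) - √(n : ℝ))) := by
        rw [mul_div_assoc]
        exact mul_le_mul_of_nonneg_left h2 (by positivity)
      rw [List.length_cons, pow_succ] at ihn ⊢
      push_cast
      linarith

/-- The strings of positive integers with first entry at least `2`. -/
def Admissible (s : List ℕ) : Prop := (∀ a ∈ s, 1 ≤ a) ∧ ∃ a l, s = a :: l ∧ 2 ≤ a

theorem summable_coeff_polylog {s : List ℕ} (hs : Admissible s) :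
    Summable fun n => coeff n (polylog s) := by
  obtain ⟨hpos, a, l, rfl, ha⟩ := hs
  have hl : ∀ b ∈ l, 1 ≤ b := fun b hb => hpos b (by simp [hb])
  refine Summable.of_nonneg_of_le (fun n => coeff_polylog_nonneg hpos n) (fun n => ?_)
    ((Real.summable_one_div_nat_rpow.2 (by norm_num : (1 : ℝ) < 3 / 2)).mul_left
      (4 ^ l.length))
  rw [coeff_polylog_cons (by omega)]
  rcases Nat.eq_zero_or_pos n with rfl | hn
  · simp
  have hn1 : (1 : ℝ) ≤ n := by exact_mod_cast hn
  have h2 : (n : ℝ) ^ (3 / 2 : ℝ) * √(n : ℝ) = (n : ℝ) ^ 2 := by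
    rw [Real.sqrt_eq_rpow, ← Real.rpow_add (by positivity), ← Real.rpow_natCast]
    norm_num
  calc (∑ i ∈ Finset.range n, coeff i (polylog l)) / (n : ℝ) ^ a
      ≤ 4 ^ l.length * √(n : ℝ) / (n : ℝ) ^ 2 :=
        div_le_div₀ (by positivity) (sum_coeff_polylog_le hl n) (by positivity)
          (pow_le_pow_right₀ hn1 ha)
    _ = 4 ^ l.length * (1 / (n : ℝ) ^ (3 / 2 : ℝ)) := by
        rw [← h2]; field_simp

end Polylog

/-! ### Multiple zeta values as sums of polylogarithm coefficients. -/

section Evaluation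

open PowerSeries
open scoped ENNReal

/-- The strictly decreasing families of positive integers satisfying a condition. -/
abbrev DecreasingTuples (d : ℕ) (P : ℕ+ → Prop) : Type :=
  {n : Fin d → ℕ+ // StrictAnti n ∧ ∀ i, P (n i)}

theorem strictAnti_cons {d : ℕ} {N : ℕ+} {n : Fin d → ℕ+} (hn : StrictAnti n)
    (hN : ∀ i, n i < N) : StrictAnti (Fin.cons N n : Fin (d + 1) → ℕ+) := by
  intro i j
  refine Fin.cases ?_ (fun i => ?_) i <;> refine Fin.cases ?_ (fun j => ?_) j
  · simp
  · simpa using hN j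
  · simp
  · simpa using @hn i j

/-- A decreasing family is its largest element followed by a decreasing family of smaller ones. -/
def decreasingTuplesSucc (d : ℕ) (P : ℕ+ → Prop) (hP : ∀ a b, a < b → P b → P a) :
    DecreasingTuples (d + 1) P ≃ Σ N : {N : ℕ+ // P N}, DecreasingTuples d (· < N.1) where
  toFun n := ⟨⟨n.1 0, n.2.2 0⟩, ⟨Fin.tail n.1, fun _ _ h => n.2.1 (Fin.succ_lt_succ_iff.2 h),
    fun i => n.2.1 (Fin.succ_pos i)⟩⟩
  invFun p := ⟨Fin.cons p.1.1 p.2.1, strictAnti_cons p.2.2.1 p.2.2.2, fun i => by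
    refine Fin.cases ?_ (fun i => ?_) i
    · simpa using p.1.2
    · simpa using hP _ _ (p.2.2.2 i) p.1.2⟩
  left_inv n := by simp
  right_inv _ := rfl

/-- The multiple zeta sum restricted to indices satisfying a condition, as an extended nonnegative
real. -/
noncomputable def restrictedZeta (s : List ℕ) (P : ℕ+ → Prop) : ℝ≥0∞ :=
  ∑' n : DecreasingTuples s.length P,
    ∏ i, ENNReal.ofReal (1 / (((n.1 i : ℕ) : ℝ) ^ s.get i))

theorem restrictedZeta_nil (P : ℕ+ → Prop) : restrictedZeta [] P = 1 := by
  have : Unique (DecreasingTuples 0 P) :=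
    { default := ⟨Fin.elim0, fun i => i.elim0, fun i => i.elim0⟩
      uniq := fun n => Subtype.ext (funext fun i => i.elim0) }
  show ∑' n : DecreasingTuples 0 P, _ = _
  simp

/-- Extended nonnegative reals allow summing over the largest index first without any summability
argument. -/
theorem restrictedZeta_cons (a : ℕ) (s : List ℕ) (P : ℕ+ → Prop)
    (hP : ∀ a b, a < b → P b → P a) :
    restrictedZeta (a :: s) P = ∑' N : {N : ℕ+ // P N},
      ENNReal.ofReal (1 / (((N.1 : ℕ) : ℝ) ^ a)) * restrictedZeta s (· < N.1) := by
  unfold restrictedZeta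
  change ∑' n : DecreasingTuples (s.length + 1) P, ∏ i : Fin (s.length + 1),
    ENNReal.ofReal (1 / (((n.1 i : ℕ) : ℝ) ^ (a :: s).get i)) = _
  rw [← (decreasingTuplesSucc s.length P hP).symm.tsum_eq, ENNReal.tsum_sigma']
  refine tsum_congr fun N => ?_
  rw [← ENNReal.tsum_mul_left]
  refine tsum_congr fun n => ?_
  rw [Fin.prod_univ_succ]
  rfl

theorem tsum_subtype_pnat (P : ℕ → Prop) [DecidablePred P] (f : ℕ → ℝ≥0∞) (h0 : f 0 = 0) :
    ∑' N : {N : ℕ+ // P N}, f N.1 = ∑' n, if P n then f n else 0 := by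
  have hinj : Function.Injective fun N : {N : ℕ+ // P N} => ((N.1 : ℕ+) : ℕ) :=
    PNat.coe_injective.comp Subtype.val_injective
  rw [← hinj.tsum_eq]
  · exact tsum_congr fun N => (if_pos N.2).symm
  · intro n hn
    rw [Function.mem_support] at hn
    by_cases hP : P n
    · rw [if_pos hP] at hn
      exact ⟨⟨⟨n, Nat.pos_of_ne_zero fun h => hn (h ▸ h0)⟩, hP⟩, rfl⟩
    · exact absurd (if_neg hP) hn

theorem coeff_zero_polylog_cons (a : ℕ) (s : List ℕ) (ha : 1 ≤ a) :
    coeff 0 (polylog (a :: s)) = 0 := by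
  rw [coeff_polylog_cons ha]; simp

theorem restrictedZeta_lt {s : List ℕ} (hs : ∀ a ∈ s, 1 ≤ a) (N : ℕ+) :
    restrictedZeta s (· < N) =
      ENNReal.ofReal (∑ i ∈ Finset.range N, coeff i (polylog s)) := by
  induction s generalizing N with
  | nil => simp [restrictedZeta_nil, coeff_polylog_nil]
  | cons a s ih =>
    have hs' : ∀ b ∈ s, 1 ≤ b := fun b hb => hs b (by simp [hb])
    rw [restrictedZeta_cons a s _ fun a b hab hb => hab.trans hb]
    have h : ∀ M : ℕ+, ENNReal.ofReal (1 / (((M : ℕ) : ℝ) ^ a)) * restrictedZeta s (· < M) =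
        ENNReal.ofReal (coeff M (polylog (a :: s))) := by
      intro M
      rw [ih hs', ← ENNReal.ofReal_mul (by positivity), coeff_polylog_cons (hs a (by simp)),
        one_div_mul_eq_div]
    simp only [h]
    have := tsum_subtype_pnat (fun n => n < (N : ℕ))
      (fun n => ENNReal.ofReal (coeff n (polylog (a :: s))))
      (by simp [coeff_zero_polylog_cons a s (hs a (by simp))])
    refine Eq.trans this ?_
    rw [tsum_eq_sum (s := Finset.range N) (fun n hn => if_neg (by simpa using hn)),
      ENNReal.ofReal_sum_of_nonneg fun i _ => coeff_polylog_nonneg hs i]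
    exact Finset.sum_congr rfl fun n hn => if_pos (by simpa using hn)

theorem mzv_eq_toReal (s : List ℕ) : mzv s = (restrictedZeta s fun _ => True).toReal := by
  unfold restrictedZeta mzv
  rw [ENNReal.tsum_toReal_eq fun n => ENNReal.prod_ne_top fun i _ => ENNReal.ofReal_ne_top]
  rw [← (Equiv.subtypeEquivRight (p := fun n : Fin s.length → ℕ+ => StrictAnti n)
    (q := fun n => StrictAnti n ∧ ∀ _, True) fun n => by simp).tsum_eq]
  refine tsum_congr fun n => ?_
  rw [ENNReal.toReal_prod]
  refine Finset.prod_congr rfl fun i _ => ?_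
  rw [ENNReal.toReal_ofReal (by positivity)]
  rfl

/-- Multiple zeta values are values of multiple polylogarithms at `1`. -/
theorem mzv_eq_tsum_coeff {s : List ℕ} (hs : Admissible s) :
    mzv s = ∑' n, coeff n (polylog s) := by
  obtain ⟨hpos, a, l, rfl, -⟩ := hs
  have ha := hpos a (by simp)
  have hl : ∀ b ∈ l, 1 ≤ b := fun b hb => hpos b (by simp [hb])
  rw [mzv_eq_toReal, restrictedZeta_cons a l _ fun _ _ _ _ => trivial]
  have h : ∀ M : ℕ+, ENNReal.ofReal (1 / (((M : ℕ) : ℝ) ^ a)) * restrictedZeta l (· < M) =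
      ENNReal.ofReal (coeff M (polylog (a :: l))) := by
    intro M
    rw [restrictedZeta_lt hl, ← ENNReal.ofReal_mul (by positivity), coeff_polylog_cons ha,
      one_div_mul_eq_div]
  simp only [h]
  rw [tsum_subtype_pnat (fun _ => True) (fun n => ENNReal.ofReal (coeff n (polylog (a :: l))))
    (by simp [coeff_zero_polylog_cons a l ha])]
  simp only [if_true]
  rw [ENNReal.tsum_toReal_eq fun n => ENNReal.ofReal_ne_top]
  exact tsum_congr fun n => ENNReal.toReal_ofReal (coeff_polylog_nonneg hpos n)

/-- A linear functional on power series that gives the value at `1` whenever the coefficients are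
summable. -/
theorem exists_linearMap_eq_tsum_coeff :
    ∃ φ : ℝ⟦X⟧ →ₗ[ℝ] ℝ, ∀ f : ℝ⟦X⟧, (Summable fun n => coeff n f) → φ f = ∑' n, coeff n f := by
  let p : Submodule ℝ ℝ⟦X⟧ :=
    { carrier := {f | Summable fun n => coeff n f}
      zero_mem' := by simp
      add_mem' := fun {f g} hf hg => by simpa using Summable.add hf hg
      smul_mem' := fun c f hf => by simpa using Summable.mul_left c hf }
  let ψ : p →ₗ[ℝ] ℝ :=
    { toFun := fun f => ∑' n, coeff n f.1
      map_add' := fun f g => by simpa using Summable.tsum_add f.2 g.2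
      map_smul' := fun c f => by simpa using Summable.tsum_mul_left c f.2 }
  -- An arbitrary extension to all power series lets the functional pass through finite sums with no
  -- convergence side conditions.
  obtain ⟨φ, hφ⟩ := LinearMap.exists_extend ψ
  exact ⟨φ, fun f hf => LinearMap.congr_fun hφ ⟨f, hf⟩⟩

/-- The value at `1` turns products of polylogarithms into products of multiple zeta values. -/
theorem exists_linearMap_eq_mzv :
    ∃ φ : ℝ⟦X⟧ →ₗ[ℝ] ℝ, (∀ s, Admissible s → φ (polylog s) = mzv s) ∧
      ∀ s s', Admissible s → Admissible s' → φ (polylog s * polylog s') = mzv s * mzv s' := by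
  obtain ⟨φ, hφ⟩ := exists_linearMap_eq_tsum_coeff
  refine ⟨φ, fun s hs => ?_, fun s s' hs hs' => ?_⟩
  · rw [hφ _ (summable_coeff_polylog hs), mzv_eq_tsum_coeff hs]
  · have h := (summable_coeff_polylog hs).norm
    have h' := (summable_coeff_polylog hs').norm
    rw [mzv_eq_tsum_coeff hs, mzv_eq_tsum_coeff hs',
      tsum_mul_tsum_eq_tsum_sum_antidiagonal_of_summable_norm h h', hφ]
    · exact tsum_congr fun n => coeff_mul n _ _
    · simp only [coeff_mul]
      exact (summable_norm_sum_mul_antidiagonal_of_summable_norm h h').of_norm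

end Evaluation

/-! ### Convergence of the strings that occur. -/

section Admissibility

theorem ones_pos (r : ℕ) : ∀ a ∈ ones r, 1 ≤ a := by
  intro a ha
  rw [List.eq_of_mem_replicate ha]

theorem Admissible.append {u v : List ℕ} (hu : Admissible u) (hv : ∀ a ∈ v, 1 ≤ a) :
    Admissible (u ++ v) := by
  obtain ⟨hpos, a, l, rfl, ha⟩ := hu
  refine ⟨fun b hb => ?_, a, l ++ v, rfl, ha⟩
  exact (List.mem_append.1 hb).elim (hpos b) (hv b)

theorem admissible_addFirst {c : ℕ} (hc : 1 ≤ c) {u : List ℕ} (hu : u ≠ [])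
    (hpos : ∀ a ∈ u, 1 ≤ a) : Admissible (addFirst c u) := by
  refine ⟨addFirst_pos c hpos, ?_⟩
  obtain ⟨a, u, rfl⟩ := List.exists_cons_of_ne_nil hu
  have := hpos a (by simp)
  exact ⟨a + c, u, rfl, by omega⟩

theorem admissible_addFirst_ofFn {c d w : ℕ} (hc : 1 ≤ c) {α : Fin (d + 1) → ℕ}
    (hα : α ∈ compositions (d + 1) w) : Admissible (addFirst c (List.ofFn α)) :=
  admissible_addFirst hc (ofFn_succ_ne_nil α) (pos_of_mem_ofFn hα)

/-- Enlarging the last entry of an admissible string and appending positive entries keeps it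
admissible. -/
theorem Admissible.dropLast_append {u v : List ℕ} {b : ℕ} (hu : Admissible u)
    (hb : u.getLastD 0 ≤ b) (hv : ∀ a ∈ v, 1 ≤ a) : Admissible (u.dropLast ++ b :: v) := by
  obtain ⟨hpos, a, l, h, ha⟩ := hu
  obtain ⟨u, x, rfl⟩ := List.eq_nil_or_concat' u |>.resolve_left (by simp [h])
  have hx := hpos x (by simp)
  rw [List.getLastD_concat] at hb
  rw [List.dropLast_concat]
  constructor
  · intro y hy
    rcases List.mem_append.1 hy with hy | hy
    · exact hpos y (by simp [hy])
    · rcases List.mem_cons.1 hy with rfl | hy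
      · omega
      · exact hv y hy
  · cases u with
    | nil =>
      obtain ⟨rfl, rfl⟩ : x = a ∧ [] = l := by simpa using h
      exact ⟨b, v, rfl, by omega⟩
    | cons y u =>
      obtain ⟨rfl, -⟩ : y = a ∧ u ++ [x] = l := by simpa using h
      exact ⟨y, u ++ b :: v, rfl, ha⟩

theorem admissible_addLast {u : List ℕ} (hu : Admissible u) (c : ℕ) :
    Admissible (addLast c u) := by
  have h : addLast c u = u.dropLast ++ (u.getLastD 0 + c) :: [] := by
    obtain ⟨-, a, l, h, -⟩ := hu
    obtain ⟨u, x, rfl⟩ := List.eq_nil_or_concat' u |>.resolve_left (by simp [h])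
    rw [addLast_concat, List.getLastD_concat, List.dropLast_concat]
  rw [h]
  exact hu.dropLast_append (Nat.le_add_right _ _) (by simp)

theorem admissible_fuse {u v : List ℕ} (hu : Admissible u) (c : ℕ) (hv : ∀ a ∈ v, 1 ≤ a) :
    Admissible (fuse c u v) :=
  hu.dropLast_append (by omega) fun a ha => hv a (List.mem_of_mem_tail ha)

theorem admissible_withOnes {u v : List ℕ} (hu : Admissible u) (r : ℕ) (hne : v ≠ [])
    (hv : ∀ a ∈ v, 1 ≤ a) : Admissible (withOnes r u v) := by
  unfold withOnes
  split_ifs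
  · obtain ⟨b, v, rfl⟩ := List.exists_cons_of_ne_nil hne
    have := hv b (by simp)
    exact hu.dropLast_append (by simp; omega) fun a ha => hv a (by simp at ha; simp [ha])
  · exact (hu.append (ones_pos _)).append hv

theorem admissible_cons_ones {a : ℕ} (ha : 1 ≤ a) (r : ℕ) : Admissible ([a + 1] ++ ones r) :=
  Admissible.append ⟨by simp, a + 1, [], rfl, by omega⟩ (ones_pos r)

end Admissibility

/-! ### The product formula. -/

theorem theorem1p3 (m n j k s t : ℕ) (hm : 1 ≤ m) (hn : 1 ≤ n) (hj : 1 ≤ j) (hk : 1 ≤ k)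
    (hs : 1 ≤ s) (ht : 1 ≤ t) :
    mzv ([m + 1] ++ ones (j - 1)) * mzv ([n + 1] ++ ones (k - 1) ++ [s + 1] ++ ones (t - 1)) =
      -- here `(J 0, J 1, J 2, J 3)` is `(j₁, j₂, j₃, j₄)`
      (∑ n₁ ∈ Finset.range (n + 1), ∑ J ∈ Finset.Nat.antidiagonalTuple 4 j,
        ∑ α ∈ compositions (J 0 + 1) (n - n₁ + J 0 + 1),
        ∑ α' ∈ compositions (J 2 + 1) (s + J 2),
          ((m - 1 + n₁).choose (m - 1) : ℝ) * ((J 1 + k - 1).choose (k - 1) : ℝ) *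
            ((J 3 + t - 1).choose (t - 1) : ℝ) *
          mzv (addFirst (m + n₁) (List.ofFn α) ++ ones (J 1 + k - 1) ++
            addFirst 1 (List.ofFn α') ++ ones (J 3 + t - 1))) +
      -- here `(J 0, J 1, J 2)` is `(j₁, j₂, j₃)`
      (∑ k₁ ∈ Finset.Icc 1 k, ∑ m₁ ∈ Finset.range m, ((m₁ + n - 1).choose (n - 1) : ℝ) *
        ∑ J ∈ Finset.Nat.antidiagonalTuple 3 j,
        ∑ β ∈ compositions (k₁ + 1) (m - m₁ + k₁),
        ∑ β' ∈ compositions (J 1 + 1) (s + J 1),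
          ((J 0 + k - k₁).choose (k - k₁) : ℝ) * ((J 2 + t - 1).choose (t - 1) : ℝ) *
          mzv (withOnes (J 0 + k - k₁) (addLast 1 (addFirst (m₁ + n) (List.ofFn β)))
            (addFirst 1 (List.ofFn β')) ++ ones (J 2 + t - 1))) +
      -- here `(M 0, M 1, M 2)` is `(m₁, m₂, m₃)` and `(J 0, J 1)` is `(j₁, j₂)`
      (∑ s₁ ∈ Finset.Icc 1 s, ∑ M ∈ Finset.Nat.antidiagonalTuple 3 (m - 1),
        ((M 0 + n - 1).choose (n - 1) : ℝ) * ((M 2 + s₁ - 1).choose (s₁ - 1) : ℝ) *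
        ∑ J ∈ Finset.Nat.antidiagonalTuple 2 j,
        ∑ γ ∈ compositions (k + 1) (M 1 + k + 1),
        ∑ γ' ∈ compositions (J 0 + 1) (s - s₁ + J 0 + 1),
          ((J 1 + t - 1).choose (t - 1) : ℝ) *
          mzv (fuse (M 2 + s₁) (addFirst (M 0 + n) (List.ofFn γ)) (List.ofFn γ') ++
            ones (J 1 + t - 1))) +
      -- here `(M 0, M 1, M 2, M 3)` is `(m₁, m₂, m₃, m₄)`
      (∑ t₁ ∈ Finset.Icc 1 t, ∑ M ∈ Finset.Nat.antidiagonalTuple 4 (m - 1),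
        ((M 0 + n - 1).choose (n - 1) : ℝ) * ((M 2 + s - 1).choose (s - 1) : ℝ) *
          ((j + t - t₁).choose j : ℝ) *
        ∑ δ ∈ compositions k (M 1 + k),
        ∑ δ' ∈ compositions (t₁ + 1) (M 3 + t₁ + 1),
          mzv (addFirst (M 0 + n) (List.ofFn δ) ++
            addLast 1 (addFirst (M 2 + s) (List.ofFn δ')) ++ ones (j + t - t₁ - 1))) := by
  obtain ⟨m, rfl⟩ := Nat.exists_eq_add_of_le' hm
  obtain ⟨n, rfl⟩ := Nat.exists_eq_add_of_le' hn
  obtain ⟨k, rfl⟩ := Nat.exists_eq_add_of_le' hk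
  obtain ⟨s, rfl⟩ := Nat.exists_eq_add_of_le' hs
  obtain ⟨t, rfl⟩ := Nat.exists_eq_add_of_le' ht
  have hsub : ∀ a b : ℕ, a + (b + 1) - 1 = a + b := fun _ _ => rfl
  simp only [hsub, add_zero]
  obtain ⟨φ, hφ, hφmul⟩ := exists_linearMap_eq_mzv
  -- The last x₀ is set apart as the letter to be marked.
  have hu : polylog ([m + 1 + 1] ++ ones (j - 1)) = letterProd polylogOp
      (List.replicate m false ++ false :: List.replicate j true) 1 := by
    obtain ⟨j, rfl⟩ := Nat.exists_eq_add_of_le' hj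
    simp [polylog, pow_succ _ m, pow_succ' _ j]
  have hv : polylog ([n + 1 + 1] ++ ones k ++ [s + 1 + 1] ++ ones t) =
      letterProd polylogOp (List.replicate (n + 1) false ++ (List.replicate (k + 1) true ++
        (List.replicate (s + 1) false ++ (List.replicate (t + 1) true ++ [])))) 1 := by
    simp [polylog, pow_succ' _ k, pow_succ' _ t]
  have hadm : Admissible ([n + 1 + 1] ++ ones k ++ [s + 1 + 1] ++ ones t) :=
    ((admissible_cons_ones (by omega) _).append (by simp)).append (ones_pos _)
  rw [← hφmul _ _ (admissible_cons_ones (by omega) _) hadm, hu, hv, ← shuffle_polylogOp,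
    shuffle_eq_sum_zetaWord _ _ _ _ _ _ _ hj]
  · simp only [LinearMap.add_apply, LinearMap.sum_apply, LinearMap.smul_apply, map_add, map_sum,
      map_smul, smul_eq_mul]
    refine congrArg₂ (· + ·) (congrArg₂ (· + ·) (congrArg₂ (· + ·) ?_ ?_) ?_) ?_
    · refine Finset.sum_congr rfl fun n₁ _ => Finset.sum_congr rfl fun J _ =>
        Finset.sum_congr rfl fun α hα => Finset.sum_congr rfl fun α' hα' => ?_
      refine congrArg _ (hφ _ ?_)
      exact (((admissible_addFirst_ofFn (by omega) hα).append (ones_pos _)).append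
        (addFirst_pos _ (pos_of_mem_ofFn hα'))).append (ones_pos _)
    · refine Finset.sum_congr rfl fun k₁ _ => Finset.sum_congr rfl fun m₁ _ =>
        congrArg _ (Finset.sum_congr rfl fun J _ => Finset.sum_congr rfl fun β hβ =>
          Finset.sum_congr rfl fun β' hβ' => ?_)
      refine congrArg _ (hφ _ ?_)
      exact (admissible_withOnes (admissible_addLast (admissible_addFirst_ofFn (by omega) hβ) 1) _
        (addFirst_ne_nil _ (ofFn_succ_ne_nil _))
        (addFirst_pos _ (pos_of_mem_ofFn hβ'))).append (ones_pos _)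
    · refine Finset.sum_congr rfl fun s₁ _ => Finset.sum_congr rfl fun M _ =>
        congrArg _ (Finset.sum_congr rfl fun J _ => Finset.sum_congr rfl fun γ hγ =>
          Finset.sum_congr rfl fun γ' hγ' => ?_)
      refine congrArg _ (hφ _ ?_)
      exact (admissible_fuse (admissible_addFirst_ofFn (by omega) hγ) _ (pos_of_mem_ofFn hγ')).append
        (ones_pos _)
    · refine Finset.sum_congr rfl fun t₁ _ => Finset.sum_congr rfl fun M _ =>
        congrArg _ (Finset.sum_congr rfl fun δ hδ => Finset.sum_congr rfl fun δ' hδ' => ?_)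
      refine hφ _ ?_
      exact ((admissible_addFirst_ofFn (by omega) hδ).append (addLast_pos _
        (addFirst_pos _ (pos_of_mem_ofFn hδ')))).append (ones_pos _)
  -- The first word ends in x₁ because j ≥ 1.
  · exact EndsInOne.append_left (w := false :: List.replicate j true)
      ⟨by simp; omega, endsInOne_replicate_true j⟩ (by simp) _
  · rw [List.append_nil]
    simp only [← List.append_assoc]
    exact (endsInOne_replicate_true (t + 1)).append_left (by simp) _
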